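/- Let $\mathcal H$ be an infinite-dimensional complex Hilbert space and let $\mathcal A\subseteq B(\mathcal H)$ be a standard operator algebra, i.e. a (not necessarily norm-closed) complex subalgebra of $B(\mathcal H)$ that contains every bounded operator of finite rank. Assume that $\mathcal A$ contains the identity operator $I$ and is closed under taking adjoints. For $A,B\in\mathcal A$ write $A\bullet B=AB+BA^{*}$ and $[A,B]_{*}=AB-BA^{*}$. Let $\Phi:\mathcal A\to\mathcal A$ be a map (neither linearity nor additivity is assumed). Then $$\Phi([A\bullet B,C]_{*})=[\Phi(A)\bullet B,C]_{*}+[A\bullet\Phi(B),C]_{*}+[A\bullet B,\Phi(C)]_{*}\qquad\text{for all }A,B,C\in\mathcal A$$ (that is, $\Phi$ is a nonlinear mixed Jordan triple $*$-derivation) if and only if $\Phi$ is a linear $*$-derivation, i.e. $\Phi$ is $\mathbb C$-linear, $\Phi(AB)=\Phi(A)B+A\Phi(B)$ and $\Phi(A^{*})=\Phi(A)^{*}$ for all $A,B\in\mathcal A$. Moreover, in this case there exists an operator $T\in B(\mathcal H)$ with $T+T^{*}=0$ such that $\Phi(A)=AT-TA$ for all $A\in\mathcal A$ (i.e. $\Phi$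 is inner). -/

import Mathlib

/-- The Jordan `*`-product `A • B = A B + B A*`. -/
def jordanStarProd {R : Type*} [Ring R] [StarRing R] (A B : R) : R :=
  A * B + B * star A

/-- The skew Lie product `[A, B]_* = A B - B A*`. -/
def skewLieProd {R : Type*} [Ring R] [StarRing R] (A B : R) : R :=
  A * B - B * star A

/-- A map `Φ`, with neither linearity nor additivity assumed, satisfying
`Φ([A • B, C]_*) = [Φ(A) • B, C]_* + [A • Φ(B), C]_* + [A • B, Φ(C)]_*`. -/
def IsMixedJordanTripleStarDerivation {R : Type*} [Ring R] [StarRing R] (Φ : R → R) : Prop :=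
  ∀ A B C : R,
    Φ (skewLieProd (jordanStarProd A B) C) =
      skewLieProd (jordanStarProd (Φ A) B) C
        + skewLieProd (jordanStarProd A (Φ B)) C
        + skewLieProd (jordanStarProd A B) (Φ C)

/-- Complex-linear `*`-derivations of a complex `*`-algebra. -/
structure IsLinearStarDerivation {R : Type*} [Ring R] [StarRing R] [Algebra ℂ R]
    (Φ : R → R) : Prop where
  linear : IsLinearMap ℂ Φ
  leibniz : ∀ A B : R, Φ (A * B) = Φ A * B + A * Φ B
  map_star : ∀ A : R, Φ (star A) = star (Φ A)

/-- A subalgebra of `B(H)` is a standard operator algebra if it contains every bounded operator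
of finite rank. -/
def IsStandardOperatorAlgebra {H : Type*} [NormedAddCommGroup H] [InnerProductSpace ℂ H]
    (𝒜 : Subalgebra ℂ (H →L[ℂ] H)) : Prop :=
  ∀ F : H →L[ℂ] H, FiniteDimensional ℂ (LinearMap.range (F : H →ₗ[ℂ] H)) → F ∈ 𝒜

set_option linter.unusedSectionVars false

/-! ### Skew Lie products, Peirce corners and additivity -/

section SkewLie

variable {R : Type*} [Ring R] [StarRing R]

/-! The converse is direct expansion. For the forward direction, putting `A = 1` shows that `z = Φ
1` is central and self-adjoint and that `ψ x = Φ x + z * x` derives the product `2 [B, C]_*`. Such a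
`ψ` is additive: test the defect `t = ψ (x + y) - ψ x - ψ y` against elements built from a
projection `p` and `q = 1 - p`; each test kills some Peirce corners of `t`
(`IsTwoSkewLieDerivation.map_add`). Hence `Φ` is additive. Then `Φ 1 = Φ (i 1) = 0`, and combining
the identity at `B` and at `iB` separates `BC` from `CB*`, giving the Leibniz and `*` rules. Real
homogeneity and innerness come together in `exists_eq_commutator`: `T y = d (y ⊗ e) e` implements
the derivation `d`, infinite dimension excludes a wild additive action on real scalars, and the
closed graph theorem bounds `T`. Finally `T` is replaced by a skew-adjoint operator. -/

lemma skewLieProd_add_left (a b c : R) :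
    skewLieProd (a + b) c = skewLieProd a c + skewLieProd b c := by
  simp only [skewLieProd, star_add, add_mul, mul_add]; abel

lemma skewLieProd_add_right (a b c : R) :
    skewLieProd a (b + c) = skewLieProd a b + skewLieProd a c := by
  simp only [skewLieProd, add_mul, mul_add]; abel

lemma skewLieProd_sub_left (a b c : R) :
    skewLieProd (a - b) c = skewLieProd a c - skewLieProd b c := by
  simp only [skewLieProd, star_sub, sub_mul, mul_sub]; abel

lemma skewLieProd_sub_right (a b c : R) :
    skewLieProd a (b - c) = skewLieProd a b - skewLieProd a c := by
  simp only [skewLieProd, sub_mul, mul_sub]; abel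

/-- `ψ` is a derivation of the product `2 [B, C]_*`. -/
def IsTwoSkewLieDerivation (ψ : R → R) : Prop :=
  ∀ b c, ψ (2 * skewLieProd b c) = 2 * skewLieProd (ψ b) c + 2 * skewLieProd b (ψ c)

/-- Two complementary projections. -/
structure IsProjectionPair (p q : R) : Prop where
  left_idem : p * p = p
  right_idem : q * q = q
  mul_eq_zero : p * q = 0
  mul_eq_zero' : q * p = 0
  add_eq_one : p + q = 1
  star_left : star p = p
  star_right : star q = q

lemma IsProjectionPair.symm {p q : R} (h : IsProjectionPair p q) : IsProjectionPair q p :=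
  ⟨h.right_idem, h.left_idem, h.mul_eq_zero', h.mul_eq_zero, by rw [add_comm, h.add_eq_one],
    h.star_right, h.star_left⟩

/-- Membership in the Peirce corner `p R q`. -/
def InCorner (p q a : R) : Prop := p * a = a ∧ a * q = a

lemma InCorner.add {p q a b : R} (ha : InCorner p q a) (hb : InCorner p q b) :
    InCorner p q (a + b) :=
  ⟨by rw [mul_add, ha.1, hb.1], by rw [add_mul, ha.2, hb.2]⟩

lemma InCorner.neg {p q a : R} (ha : InCorner p q a) : InCorner p q (-a) :=
  ⟨by rw [mul_neg, ha.1], by rw [neg_mul, ha.2]⟩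

lemma InCorner.mul {p q r a b : R} (ha : InCorner p q a) (hb : InCorner q r b) :
    InCorner p r (a * b) :=
  ⟨by rw [← mul_assoc, ha.1], by rw [mul_assoc, hb.2]⟩

lemma InCorner.two_mul {p q a : R} (ha : InCorner p q a) : InCorner p q (2 * a) := by
  rw [_root_.two_mul]; exact ha.add ha

lemma InCorner.smul [Algebra ℂ R] {p q a : R} (ha : InCorner p q a) (c : ℂ) :
    InCorner p q (c • a) :=
  ⟨by rw [mul_smul_comm, ha.1], by rw [smul_mul_assoc, ha.2]⟩

namespace IsProjectionPair

variable {p q : R} (h : IsProjectionPair p q)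
include h

lemma mul_corner {a r : R} (ha : InCorner q r a) : p * a = 0 := by
  rw [← ha.1, ← mul_assoc, h.mul_eq_zero, zero_mul]

lemma corner_mul {a r : R} (ha : InCorner r p a) : a * q = 0 := by
  rw [← ha.2, mul_assoc, h.mul_eq_zero, mul_zero]

lemma star_corner {a : R} (ha : InCorner p q a) : InCorner q p (star a) := by
  constructor
  · have := congrArg star ha.2
    rwa [star_mul, h.star_right] at this
  · have := congrArg star ha.1
    rwa [star_mul, h.star_left] at this

lemma star_corner' {a : R} (ha : InCorner p p a) : InCorner p p (star a) := by
  constructor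
  · have := congrArg star ha.2
    rwa [star_mul, h.star_left] at this
  · have := congrArg star ha.1
    rwa [star_mul, h.star_left] at this

lemma corner_left_left (a : R) : InCorner p p (p * a * p) :=
  ⟨by rw [← mul_assoc, ← mul_assoc, h.left_idem], by rw [mul_assoc, h.left_idem]⟩

lemma corner_left_right (a : R) : InCorner p q (p * a * q) :=
  ⟨by rw [← mul_assoc, ← mul_assoc, h.left_idem], by rw [mul_assoc, h.right_idem]⟩

lemma peirce (a : R) : a = p * a * p + (p * a * q + q * a * p) + q * a * q := by
  have : (p + q) * a * (p + q) = a := by rw [h.add_eq_one, one_mul, mul_one]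
  conv_lhs => rw [← this]
  simp only [add_mul, mul_add]; abel

lemma eq_zero_of_peirce {a : R} (h1 : p * a * p = 0) (h2 : p * a * q = 0) (h3 : q * a * p = 0)
    (h4 : q * a * q = 0) : a = 0 := by
  rw [h.peirce a, h1, h2, h3, h4]; simp

end IsProjectionPair

/-! ### Additivity by killing the Peirce corners of the defect -/

namespace IsTwoSkewLieDerivation

variable [Algebra ℂ R] {ψ : R → R}

lemma two_mul_cancel {a : R} (h : 2 * a = 0) : a = 0 := by
  have h2 : (2 : ℂ) • a = 0 := by rw [two_smul, ← two_mul, h]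
  exact (smul_eq_zero.1 h2).resolve_left two_ne_zero

lemma map_zero (hψ : IsTwoSkewLieDerivation ψ) : ψ 0 = 0 := by
  have := hψ 0 0
  simp [skewLieProd] at this
  exact this

/-- Transfer principle: additivity at the products with `c` makes `c` annihilate the defect at `x,
y`. -/
lemma defect_right (hψ : IsTwoSkewLieDerivation ψ) {c x y : R}
    (h : ψ (2 * skewLieProd c (x + y)) = ψ (2 * skewLieProd c x) + ψ (2 * skewLieProd c y)) :
    skewLieProd c (ψ (x + y) - ψ x - ψ y) = 0 := by
  rw [hψ, hψ, hψ, skewLieProd_add_right] at h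
  apply two_mul_cancel
  rw [skewLieProd_sub_right, skewLieProd_sub_right, mul_sub, mul_sub, sub_sub, sub_eq_zero]
  rw [mul_add] at h
  have := sub_eq_zero.2 h
  rw [← sub_eq_zero, ← this]; abel

lemma defect_left (hψ : IsTwoSkewLieDerivation ψ) {c x y : R}
    (h : ψ (2 * skewLieProd (x + y) c) = ψ (2 * skewLieProd x c) + ψ (2 * skewLieProd y c)) :
    skewLieProd (ψ (x + y) - ψ x - ψ y) c = 0 := by
  rw [hψ, hψ, hψ, skewLieProd_add_left] at h
  apply two_mul_cancel
  rw [skewLieProd_sub_left, skewLieProd_sub_left, mul_sub, mul_sub, sub_sub, sub_eq_zero]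
  rw [mul_add] at h
  have := sub_eq_zero.2 h
  rw [← sub_eq_zero, ← this]; abel

lemma defect_right_of_eq_zero (hψ : IsTwoSkewLieDerivation ψ) {c x y : R}
    (h : skewLieProd c x = 0) : skewLieProd c (ψ (x + y) - ψ x - ψ y) = 0 :=
  hψ.defect_right (by rw [skewLieProd_add_right, h]; simp [hψ.map_zero])

lemma defect_right_of_eq_zero' (hψ : IsTwoSkewLieDerivation ψ) {c x y : R}
    (h : skewLieProd c y = 0) : skewLieProd c (ψ (x + y) - ψ x - ψ y) = 0 :=
  hψ.defect_right (by rw [skewLieProd_add_right, h]; simp [hψ.map_zero])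

lemma defect_left_of_eq_zero (hψ : IsTwoSkewLieDerivation ψ) {c x y : R}
    (h : skewLieProd x c = 0) : skewLieProd (ψ (x + y) - ψ x - ψ y) c = 0 :=
  hψ.defect_left (by rw [skewLieProd_add_left, h]; simp [hψ.map_zero])

lemma defect_left_of_eq_zero' (hψ : IsTwoSkewLieDerivation ψ) {c x y : R}
    (h : skewLieProd y c = 0) : skewLieProd (ψ (x + y) - ψ x - ψ y) c = 0 :=
  hψ.defect_left (by rw [skewLieProd_add_left, h]; simp [hψ.map_zero])

variable [StarModule ℂ R]

/-- Multiplying by `i` makes `p` skew-adjoint and turns the skew Lie product into a Jordan product,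
which sees corners on both sides. -/
lemma skewLieProd_I_smul {p : R} (hp : star p = p) (a : R) :
    skewLieProd (Complex.I • p) a = Complex.I • (p * a + a * p) := by
  simp [skewLieProd, star_smul, hp, smul_add]

lemma skewLieProd_I_smul_eq_zero {p a : R} (hp : star p = p)
    (h : skewLieProd (Complex.I • p) a = 0) : p * a + a * p = 0 := by
  rw [skewLieProd_I_smul hp] at h
  exact (smul_eq_zero.1 h).resolve_left Complex.I_ne_zero

variable {p q : R}

/-- Since `p - q` anticommutes with off-diagonal elements, testing with `i(p - q)` kills the
diagonal corners of the defect; `[a, p]_* = 0` and `[b, q]_* = 0` kill the other two. -/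
lemma map_add_offDiag (hψ : IsTwoSkewLieDerivation ψ) (h : IsProjectionPair p q) {a b : R}
    (ha : InCorner p q a) (hb : InCorner q p b) : ψ (a + b) = ψ a + ψ b := by
  have hpq : star (p - q) = p - q := by rw [star_sub, h.star_left, h.star_right]
  have e1 := skewLieProd_I_smul_eq_zero hpq <|
    hψ.defect_right_of_eq_zero (c := Complex.I • (p - q)) (x := a) (y := b) (by
      rw [skewLieProd_I_smul hpq, sub_mul, mul_sub, ha.1, ha.2, h.symm.mul_corner ha,
        h.symm.corner_mul ha]; simp)
  have e2 := hψ.defect_left_of_eq_zero (c := p) (x := a) (y := b) (by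
    rw [skewLieProd, h.symm.corner_mul ha, h.mul_corner (h.star_corner ha), sub_zero])
  have e3 := hψ.defect_left_of_eq_zero' (c := q) (x := a) (y := b) (by
    rw [skewLieProd, h.corner_mul hb, h.symm.mul_corner (h.symm.star_corner hb), sub_zero])
  rw [← sub_eq_zero, ← sub_sub]
  generalize ψ (a + b) - ψ a - ψ b = t at *
  have f1 : q * t * p = 0 := by
    have := congrArg (q * ·) e2
    simpa [skewLieProd, mul_sub, ← mul_assoc, h.mul_eq_zero'] using this
  have f2 : p * t * q = 0 := by
    have := congrArg (p * ·) e3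
    simpa [skewLieProd, mul_sub, ← mul_assoc, h.mul_eq_zero] using this
  have f3 : p * t * p = 0 := by
    have := congrArg (p * · * p) e1
    simp only [mul_add, add_mul, sub_mul, mul_sub] at this
    simp only [← mul_assoc, h.left_idem, h.mul_eq_zero, zero_mul, mul_zero, sub_zero] at this
    simp only [mul_assoc, h.left_idem, h.mul_eq_zero', mul_zero, sub_zero] at this
    rw [← two_mul] at this
    rw [mul_assoc]
    exact two_mul_cancel this
  have f4 : q * t * q = 0 := by
    have := congrArg (q * · * q) e1
    simp only [mul_add, add_mul, sub_mul, mul_sub] at this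
    simp only [← mul_assoc, h.right_idem, h.mul_eq_zero', zero_mul, mul_zero, zero_sub] at this
    simp only [mul_assoc, h.right_idem, h.mul_eq_zero, mul_zero, zero_sub] at this
    rw [← neg_add, ← two_mul, neg_eq_zero] at this
    rw [mul_assoc]
    exact two_mul_cancel this
  exact h.eq_zero_of_peirce f3 f2 f1 f4

lemma corners_of_defect (h : IsProjectionPair p q) {t : R} (e : p * t + t * p = 0) :
    p * t * p = 0 ∧ p * t * q = 0 ∧ q * t * p = 0 := by
  refine ⟨?_, ?_, ?_⟩
  · have := congrArg (p * · * p) e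
    simp only [mul_add, add_mul, ← mul_assoc, h.left_idem, mul_zero, zero_mul] at this
    rw [mul_assoc (p * t), h.left_idem, ← two_mul] at this
    exact two_mul_cancel this
  · have := congrArg (p * · * q) e
    simp only [mul_add, add_mul, ← mul_assoc, h.left_idem, mul_zero, zero_mul] at this
    rwa [mul_assoc (p * t), h.mul_eq_zero, mul_zero, add_zero] at this
  · have := congrArg (q * · * p) e
    simp only [mul_add, ← mul_assoc, h.mul_eq_zero', mul_zero, zero_mul, zero_add] at this
    rwa [mul_assoc (q * t), h.left_idem] at this

/-- `i(p - q)` annihilates `b + c` and `iq` annihilates `a`; adding the two resulting relations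
gives the one for `p`. -/
lemma map_add_diag_offDiag (hψ : IsTwoSkewLieDerivation ψ) (h : IsProjectionPair p q) {a b c : R}
    (ha : InCorner p p a) (hb : InCorner p q b) (hc : InCorner q p c) :
    ψ (a + (b + c)) = ψ a + ψ (b + c) := by
  have hpq : star (p - q) = p - q := by rw [star_sub, h.star_left, h.star_right]
  have e1 := skewLieProd_I_smul_eq_zero hpq <|
    hψ.defect_right_of_eq_zero' (c := Complex.I • (p - q)) (x := a) (y := b + c) (by
      rw [skewLieProd_I_smul hpq, sub_mul, mul_sub, mul_add, mul_add, add_mul, add_mul,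
        hb.1, hb.2, hc.1, hc.2, h.symm.mul_corner hb, h.mul_corner hc, h.corner_mul hc,
        h.symm.corner_mul hb]; simp)
  have e2 := skewLieProd_I_smul_eq_zero h.star_right <|
    hψ.defect_right_of_eq_zero (c := Complex.I • q) (x := a) (y := b + c) (by
      rw [skewLieProd_I_smul h.star_right, h.symm.mul_corner ha, h.corner_mul ha]; simp)
  rw [← sub_eq_zero, ← sub_sub]
  generalize ψ (a + (b + c)) - ψ a - ψ (b + c) = t at *
  obtain ⟨f4, f3, f2⟩ := corners_of_defect h.symm e2
  have e3 : p * t + t * p = 0 := by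
    have : p * t + t * p = ((p - q) * t + t * (p - q)) + (q * t + t * q) := by noncomm_ring
    rw [this, e1, e2, add_zero]
  exact h.eq_zero_of_peirce (corners_of_defect h e3).1 f2 f3 f4

lemma inCorner_zero (p q : R) : InCorner p q 0 := ⟨mul_zero p, zero_mul q⟩

lemma map_add_peirce (hψ : IsTwoSkewLieDerivation ψ) (h : IsProjectionPair p q) {a b c d : R}
    (ha : InCorner p p a) (hb : InCorner p q b) (hc : InCorner q p c) (hd : InCorner q q d) :
    ψ (a + (b + c) + d) = ψ a + ψ b + ψ c + ψ d := by
  have e1 := skewLieProd_I_smul_eq_zero h.star_left <|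
    hψ.defect_right_of_eq_zero' (c := Complex.I • p) (x := a + (b + c)) (y := d) (by
      rw [skewLieProd_I_smul h.star_left, h.mul_corner hd, h.symm.corner_mul hd]; simp)
  have k1 : skewLieProd (Complex.I • q) (a + (b + c)) = Complex.I • c + Complex.I • b := by
    rw [skewLieProd_I_smul h.star_right, mul_add, mul_add, add_mul, add_mul, hb.2, hc.1,
      h.symm.mul_corner ha, h.corner_mul ha, h.symm.mul_corner hb, h.corner_mul hc,
      ← smul_add]
    simp
  have k2 : skewLieProd (Complex.I • q) d = Complex.I • (d + d) := by
    rw [skewLieProd_I_smul h.star_right, hd.1, hd.2]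
  -- `iq` removes `a`, leaving a sum of the previous type with `p` and `q` exchanged.
  have e2 := skewLieProd_I_smul_eq_zero h.star_right <|
    hψ.defect_right (c := Complex.I • q) (x := a + (b + c)) (y := d) (by
      rw [skewLieProd_add_right, k1, k2, add_comm, mul_add, mul_add,
        hψ.map_add_diag_offDiag h.symm ((hd.add hd).smul _).two_mul (hc.smul _).two_mul
          (hb.smul _).two_mul, add_comm])
  have e3 : ψ (a + (b + c) + d) = ψ (a + (b + c)) + ψ d := by
    rw [← sub_eq_zero, ← sub_sub]
    obtain ⟨f1, f2, f3⟩ := corners_of_defect h e1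
    exact h.eq_zero_of_peirce f1 f2 f3 (corners_of_defect h.symm e2).1
  rw [e3, hψ.map_add_diag_offDiag h ha hb hc, hψ.map_add_offDiag h hb hc]
  abel

/-- The product `[p + a, q + b]_* = (a + b) - a* - b a*` contains `a + b` alone in its corner;
expanding it by the derivation rule and comparing with the four separate products isolates `ψ (2 (a
+ b))`. -/
lemma map_add_corner_offDiag (hψ : IsTwoSkewLieDerivation ψ) (h : IsProjectionPair p q) {a b : R}
    (ha : InCorner p q a) (hb : InCorner p q b) : ψ (a + b) = ψ a + ψ b := by
  have hp : InCorner p p p := ⟨h.left_idem, h.left_idem⟩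
  have hq : InCorner q q q := ⟨h.right_idem, h.right_idem⟩
  suffices H : ∀ {a b : R}, InCorner p q a → InCorner p q b →
      ψ (2 * (a + b)) = ψ (2 * a) + ψ (2 * b) by
    have half : ∀ x : R, x = 2 * ((2⁻¹ : ℂ) • x) := fun x => by
      rw [two_mul, ← two_smul ℂ, smul_smul]; norm_num
    have := H (ha.smul (2⁻¹ : ℂ)) (hb.smul (2⁻¹ : ℂ))
    rwa [mul_add, ← half, ← half] at this
  intro a b ha hb
  have hsa := h.star_corner ha
  have k1 : ψ (p + a) = ψ p + ψ a := by
    simpa using hψ.map_add_diag_offDiag h hp ha (inCorner_zero q p)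
  have k2 : ψ (q + b) = ψ q + ψ b := by
    simpa using hψ.map_add_diag_offDiag h.symm hq (inCorner_zero q p) hb
  have s1 : skewLieProd p q = 0 := by
    rw [skewLieProd, h.star_left, h.mul_eq_zero, h.mul_eq_zero', sub_zero]
  have s2 : skewLieProd p b = b := by
    rw [skewLieProd, h.star_left, hb.1, h.symm.corner_mul hb, sub_zero]
  have s3 : skewLieProd a q = a + -star a := by
    rw [skewLieProd, ha.2, hsa.1, sub_eq_add_neg]
  have s4 : skewLieProd a b = -(b * star a) := by
    rw [skewLieProd, ← hb.1, ← mul_assoc a, h.symm.corner_mul ha, zero_mul, zero_sub, hb.1]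
  have e := hψ (p + a) (q + b)
  have e1 : 2 * skewLieProd (p + a) (q + b) =
      2 * (-(b * star a)) + (2 * (a + b) + 2 * (-star a)) := by
    rw [skewLieProd_add_left, skewLieProd_add_right, skewLieProd_add_right, s1, s2, s3, s4]
    noncomm_ring
  rw [e1, hψ.map_add_diag_offDiag h (hb.mul hsa).neg.two_mul (ha.add hb).two_mul hsa.neg.two_mul,
    hψ.map_add_offDiag h (ha.add hb).two_mul hsa.neg.two_mul, k1, k2] at e
  have t1 := hψ p q
  have t2 := hψ p b
  have t3 := hψ a q
  have t4 := hψ a b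
  rw [s1, mul_zero, hψ.map_zero] at t1
  rw [s2] at t2
  rw [s3, mul_add, hψ.map_add_offDiag h ha.two_mul hsa.neg.two_mul] at t3
  rw [s4] at t4
  simp only [skewLieProd_add_left, skewLieProd_add_right, mul_add] at e
  have e' : ψ (2 * -(b * star a)) + (ψ (2 * (a + b)) + ψ (2 * -star a)) =
      0 + ψ (2 * b) + (ψ (2 * a) + ψ (2 * -star a)) + ψ (2 * -(b * star a)) := by
    rw [t1, t2, t3, t4, mul_add, ← t4, e, t4]
    abel
  rw [← sub_eq_zero] at e' ⊢
  rw [← e']; abel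

/-- Right multiplication by the `p, q` corner moves `a` and `b` into that corner, where additivity
is known; `hfaith` then recovers `p * t * p = 0`. -/
lemma map_add_corner_diag (hψ : IsTwoSkewLieDerivation ψ) (h : IsProjectionPair p q)
    (hfaith : ∀ x : R, (∀ y, p * x * p * y * q = 0) → p * x * p = 0) {a b : R}
    (ha : InCorner p p a) (hb : InCorner p p b) : ψ (a + b) = ψ a + ψ b := by
  have e1 := skewLieProd_I_smul_eq_zero h.star_right <|
    hψ.defect_right_of_eq_zero (c := Complex.I • q) (x := a) (y := b) (by
      rw [skewLieProd_I_smul h.star_right, h.symm.mul_corner ha, h.corner_mul ha]; simp)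
  have e2 : ∀ y, InCorner p q y → skewLieProd (ψ (a + b) - ψ a - ψ b) y = 0 := by
    intro y hy
    have k : ∀ x, InCorner p p x → skewLieProd x y = x * y := fun x hx => by
      rw [skewLieProd, ← hy.2, mul_assoc y, h.symm.mul_corner (h.star_corner' hx), mul_zero,
        sub_zero, hy.2]
    apply hψ.defect_left
    rw [k _ (ha.add hb), k _ ha, k _ hb, add_mul, mul_add]
    exact hψ.map_add_corner_offDiag h (ha.mul hy).two_mul (hb.mul hy).two_mul
  rw [← sub_eq_zero, ← sub_sub]
  generalize ψ (a + b) - ψ a - ψ b = t at *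
  obtain ⟨f4, f3, f2⟩ := corners_of_defect h.symm e1
  refine h.eq_zero_of_peirce (hfaith t fun y => ?_) f2 f3 f4
  have := congrArg (p * · * q) (e2 (p * y * q) (h.corner_left_right y))
  have f2' : q * star t * q = 0 := by
    have := congrArg star f4
    simpa [h.star_right, mul_assoc] using this
  simp only [skewLieProd, mul_sub, sub_mul, mul_zero, zero_mul] at this
  have z1 : p * (p * y * q * star t) * q = p * y * (q * star t * q) := by
    simp only [← mul_assoc, h.left_idem]
  have z2 : p * (t * (p * y * q)) * q = p * t * p * y * q := by
    simp only [mul_assoc, h.right_idem]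
  rwa [z1, z2, f2', mul_zero, sub_zero] at this

theorem map_add (hψ : IsTwoSkewLieDerivation ψ) (h : IsProjectionPair p q)
    (hp : ∀ x : R, (∀ y, p * x * p * y * q = 0) → p * x * p = 0)
    (hq : ∀ x : R, (∀ y, q * x * q * y * p = 0) → q * x * q = 0) (x y : R) :
    ψ (x + y) = ψ x + ψ y := by
  have key : ∀ z, ψ z = ψ (p * z * p) + ψ (p * z * q) + ψ (q * z * p) + ψ (q * z * q) :=
    fun z => by
      conv_lhs => rw [h.peirce z]
      exact hψ.map_add_peirce h (h.corner_left_left z) (h.corner_left_right z)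
        (h.symm.corner_left_right z) (h.symm.corner_left_left z)
  rw [key (x + y), key x, key y]
  simp only [mul_add, add_mul]
  rw [hψ.map_add_corner_diag h hp (h.corner_left_left x) (h.corner_left_left y),
    hψ.map_add_corner_diag h.symm hq (h.symm.corner_left_left x) (h.symm.corner_left_left y),
    hψ.map_add_corner_offDiag h (h.corner_left_right x) (h.corner_left_right y),
    hψ.map_add_corner_offDiag h.symm (h.symm.corner_left_right x) (h.symm.corner_left_right y)]
  abel

end IsTwoSkewLieDerivation
end SkewLie

/-! ### From mixed triple derivations to the Leibniz rule -/

section MixedJordan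

variable {R : Type*} [Ring R] [StarRing R] [Algebra ℂ R] [StarModule ℂ R] {Φ : R → R}

open IsTwoSkewLieDerivation in
lemma eq_of_two_mul_eq {a b : R} (h : 2 * a = 2 * b) : a = b := by
  rw [← sub_eq_zero] at h ⊢
  rw [← mul_sub] at h
  exact two_mul_cancel h

theorem IsLinearStarDerivation.isMixedJordanTripleStarDerivation (h : IsLinearStarDerivation Φ) :
    IsMixedJordanTripleStarDerivation Φ := by
  intro a b c
  have hadd := h.linear.map_add
  have hsub := h.linear.map_sub
  simp only [skewLieProd, jordanStarProd, hadd, hsub, h.leibniz, h.map_star, star_add, star_mul,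
    star_star]
  noncomm_ring

namespace IsMixedJordanTripleStarDerivation

variable (h : IsMixedJordanTripleStarDerivation Φ)
include h

lemma map_zero : Φ 0 = 0 := by
  have := h 0 0 0
  simpa [skewLieProd, jordanStarProd] using this

lemma star_map_one : star (Φ 1) = Φ 1 := by
  have := h 1 1 1
  simp only [jordanStarProd, skewLieProd, mul_one, one_mul, star_one, star_add, star_star, sub_self,
    h.map_zero] at this
  symm
  apply eq_of_two_mul_eq
  rw [← sub_eq_zero, ← sub_eq_zero.2 this.symm]
  noncomm_ring

lemma map_one_comm (c : R) : Φ 1 * c = c * Φ 1 := by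
  have := h 1 1 c
  have e : (1 + 1) * c - c * (1 + 1) = 0 := by noncomm_ring
  have e' : (1 + 1) * Φ c - Φ c * (1 + 1) = 0 := by noncomm_ring
  simp only [jordanStarProd, skewLieProd, mul_one, one_mul, star_one, star_add, h.star_map_one,
    e, e', h.map_zero] at this
  apply eq_of_two_mul_eq
  apply eq_of_two_mul_eq
  rw [← sub_eq_zero, ← sub_eq_zero.2 this.symm]
  noncomm_ring

lemma skewLieProd_map_one_mul_left (b c : R) :
    skewLieProd (Φ 1 * b) c = Φ 1 * skewLieProd b c := by
  rw [skewLieProd, skewLieProd, star_mul, h.star_map_one, ← mul_assoc c, ← h.map_one_comm,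
    mul_sub, mul_assoc]

lemma skewLieProd_map_one_mul_right (b c : R) :
    skewLieProd b (Φ 1 * c) = Φ 1 * skewLieProd b c := by
  rw [skewLieProd, skewLieProd, ← mul_assoc b, ← h.map_one_comm, mul_sub, mul_assoc, mul_assoc]

lemma map_two_mul_skewLieProd (b c : R) :
    Φ (2 * skewLieProd b c) = 2 * (Φ 1 * skewLieProd b c) + 2 * skewLieProd (Φ b) c +
      2 * skewLieProd b (Φ c) := by
  have hone : ∀ x : R, jordanStarProd 1 x = x + x := fun x => by
    simp [jordanStarProd]
  have hz : jordanStarProd (Φ 1) b = Φ 1 * b + Φ 1 * b := by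
    rw [jordanStarProd, h.star_map_one, h.map_one_comm]
  have := h 1 b c
  rw [hone, hone, hz] at this
  simp only [skewLieProd_add_left, h.skewLieProd_map_one_mul_left] at this
  simpa only [two_mul] using this

/-- The central self-adjoint `Φ 1` pulls out of either slot, so the correction counts once on the
left and twice on the right, absorbing the extra term. -/
lemma isTwoSkewLieDerivation : IsTwoSkewLieDerivation (fun x => Φ x + Φ 1 * x) := by
  intro b c
  simp only [h.map_two_mul_skewLieProd]
  rw [skewLieProd_add_left, skewLieProd_add_right, h.skewLieProd_map_one_mul_left,
    h.skewLieProd_map_one_mul_right]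
  noncomm_ring

/-- Because `i • x = 0` for every `x`, taking `C = 1` makes `Φ(i) • b` self-adjoint for all `b`;
replacing `b` by `ib` makes it zero. -/
lemma jordanStarProd_map_I (b : R) : jordanStarProd (Φ (Complex.I • 1)) b = 0 := by
  have hI : ∀ x : R, jordanStarProd (Complex.I • (1 : R)) x = 0 := fun x => by
    simp [jordanStarProd]
  have key : ∀ b, star (jordanStarProd (Φ (Complex.I • 1)) b) =
      jordanStarProd (Φ (Complex.I • 1)) b := by
    intro b
    have := h (Complex.I • 1) b 1
    rw [hI, hI] at this
    simp only [skewLieProd, star_zero, zero_mul, mul_zero, sub_zero, h.map_zero, add_zero, mul_one,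
      one_mul] at this
    exact (sub_eq_zero.1 this.symm).symm
  have e := key (Complex.I • b)
  have e' : jordanStarProd (Φ (Complex.I • 1)) (Complex.I • b) =
      Complex.I • jordanStarProd (Φ (Complex.I • 1)) b := by
    simp [jordanStarProd]
  rw [e', star_smul, key b] at e
  have e2 : (2 * Complex.I) • jordanStarProd (Φ (Complex.I • 1)) b = 0 := by
    rw [mul_smul, two_smul]
    nth_rewrite 1 [← e]
    simp
  exact (smul_eq_zero.1 e2).resolve_left (by simp)

variable (hadd : ∀ x y, Φ (x + y) = Φ x + Φ y)
include hadd

lemma map_skewLieProd_aux (b c : R) :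
    Φ (skewLieProd b c) = Φ 1 * skewLieProd b c + skewLieProd (Φ b) c +
      skewLieProd b (Φ c) := by
  have := h.map_two_mul_skewLieProd b c
  rw [two_mul, hadd, ← two_mul] at this
  apply eq_of_two_mul_eq
  rw [this]; noncomm_ring

lemma map_I_smul_aux (c : R) :
    Φ (Complex.I • c) = Complex.I • (Φ 1 * c) + Φ (Complex.I • 1) * c + Complex.I • Φ c := by
  have hI : ∀ x : R, skewLieProd (Complex.I • (1 : R)) x = 2 * (Complex.I • x) := fun x => by
    simp [skewLieProd, two_mul]
  have e := h.map_skewLieProd_aux hadd (Complex.I • 1) c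
  have hc := h.jordanStarProd_map_I c
  rw [hI, hI, two_mul, hadd, ← two_mul] at e
  apply eq_of_two_mul_eq
  rw [e]
  simp only [jordanStarProd, ] at hc
  rw [skewLieProd]
  rw [← eq_neg_iff_add_eq_zero] at hc
  rw [hc]
  simp only [two_mul, mul_add, ← mul_smul_comm]
  abel

lemma map_one_eq_zero : Φ 1 = 0 := by
  have e := h.map_I_smul_aux hadd 1
  rw [mul_one, mul_one] at e
  have : (2 * Complex.I) • Φ 1 = 0 := by
    rw [mul_smul, two_smul]
    rw [← sub_eq_zero] at e
    rw [← neg_eq_zero, ← e]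
    abel
  exact (smul_eq_zero.1 this).resolve_left (by simp)

lemma map_neg (x : R) : Φ (-x) = -Φ x := by
  have := hadd x (-x)
  rw [add_neg_cancel, h.map_zero] at this
  exact (neg_eq_of_add_eq_zero_right this.symm).symm

lemma map_I_eq_zero : Φ (Complex.I • 1) = 0 := by
  have e := h.map_I_smul_aux hadd (Complex.I • 1)
  rw [smul_smul, Complex.I_mul_I, neg_one_smul, h.map_neg hadd, h.map_one_eq_zero hadd,
    zero_mul, mul_smul_comm, mul_one, neg_zero, smul_zero, zero_add, ← two_smul ℂ,
    smul_smul] at e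
  exact (smul_eq_zero.1 e.symm).resolve_left (by simp)

lemma map_I_smul (c : R) : Φ (Complex.I • c) = Complex.I • Φ c := by
  rw [h.map_I_smul_aux hadd, h.map_one_eq_zero hadd, h.map_I_eq_zero hadd]; simp

lemma map_skewLieProd (b c : R) :
    Φ (skewLieProd b c) = skewLieProd (Φ b) c + skewLieProd b (Φ c) := by
  rw [h.map_skewLieProd_aux hadd, h.map_one_eq_zero hadd]; simp

lemma map_star (b : R) : Φ (star b) = star (Φ b) := by
  have := h.map_skewLieProd hadd b 1
  rw [h.map_one_eq_zero hadd] at this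
  simp only [skewLieProd, mul_one, one_mul, zero_mul, mul_zero, sub_zero, add_zero] at this
  rwa [sub_eq_add_neg, hadd, h.map_neg hadd, sub_eq_add_neg, add_right_inj, neg_inj] at this

/-- The identity at `b` controls `bc - cb*`, the one at `ib` controls `bc + cb*`; their sum isolates
`bc`. -/
lemma leibniz (b c : R) : Φ (b * c) = Φ b * c + b * Φ c := by
  have e1 := h.map_skewLieProd hadd b c
  have e2 := h.map_skewLieProd hadd (Complex.I • b) c
  have k : ∀ x y : R, skewLieProd (Complex.I • x) y = Complex.I • (x * y + y * star x) := by
    intro x y; simp [skewLieProd]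
  rw [h.map_I_smul hadd, k, k, k, h.map_I_smul hadd, ← smul_add] at e2
  replace e2 := smul_right_injective R Complex.I_ne_zero e2
  simp only [skewLieProd, sub_eq_add_neg, hadd, h.map_neg hadd] at e1 e2
  apply eq_of_two_mul_eq
  calc 2 * Φ (b * c) = (Φ (b * c) + -Φ (c * star b)) + (Φ (b * c) + Φ (c * star b)) := by
        noncomm_ring
    _ = _ := by rw [e1, e2]; noncomm_ring

omit hadd in
theorem map_add {p q : R} (hpq : IsProjectionPair p q)
    (hp : ∀ x : R, (∀ y, p * x * p * y * q = 0) → p * x * p = 0)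
    (hq : ∀ x : R, (∀ y, q * x * q * y * p = 0) → q * x * q = 0) (x y : R) :
    Φ (x + y) = Φ x + Φ y := by
  have e := h.isTwoSkewLieDerivation.map_add hpq hp hq x y
  simp only [mul_add] at e
  have : Φ (x + y) + (Φ 1 * x + Φ 1 * y) = (Φ x + Φ y) + (Φ 1 * x + Φ 1 * y) := by
    rw [e]; abel
  exact add_right_cancel this

end IsMixedJordanTripleStarDerivation
end MixedJordan

/-! ### Additive derivations are inner -/

section Inner

open scoped InnerProductSpace

/-- Such an `f` is `ℚ`-linear and vanishes on `ℚ`, so `m (c₀ - q)` is tiny for rational `q` near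
`c₀` while its image is `m f(c₀)`. -/
lemma exists_small_of_additive (f : ℝ →+ ℂ) (h1 : f 1 = 0) {c₀ : ℝ} (hc : f c₀ ≠ 0) {ε : ℝ}
    (hε : 0 < ε) (M : ℝ) : ∃ c : ℝ, |c| ≤ ε ∧ M ≤ ‖f c‖ := by
  have hrat : ∀ (q : ℚ) (x : ℝ), f (q * x) = q * f x := fun q x => by
    simpa using map_ratCast_smul f ℝ ℂ q x
  obtain ⟨m, hm⟩ := exists_nat_ge (M / ‖f c₀‖)
  obtain ⟨q, hq1, hq2⟩ := exists_rat_btwn (show c₀ - ε / (m + 1) < c₀ from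
    sub_lt_self _ (by positivity))
  have hfq : f q = 0 := by simpa [h1] using hrat q 1
  refine ⟨(m : ℚ) * (c₀ - q), ?_, ?_⟩
  · have h0 : 0 ≤ c₀ - q := by linarith
    have h2 : c₀ - q ≤ ε / (m + 1) := by linarith
    rw [abs_of_nonneg (mul_nonneg (by simp) h0)]
    rw [le_div_iff₀ (by positivity)] at h2
    push_cast
    nlinarith
  · rw [hrat, map_sub, hfq, sub_zero, norm_mul]
    rw [div_le_iff₀ (norm_pos_iff.2 hc)] at hm
    simpa using hm

variable {H : Type*} [NormedAddCommGroup H] [InnerProductSpace ℂ H]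

lemma exists_orthonormal_nat (hH : ¬ FiniteDimensional ℂ H) :
    ∃ v : ℕ → H, Orthonormal ℂ v := by
  let b := Module.Basis.ofVectorSpace ℂ H
  have : Infinite (Module.Basis.ofVectorSpaceIndex ℂ H) := by
    by_contra hinf
    rw [not_infinite_iff_finite] at hinf
    exact hH (Module.Finite.of_basis b)
  exact ⟨_, InnerProductSpace.gramSchmidtNormed_orthonormal
    (b.linearIndependent.comp _ (Infinite.natEmbedding _).injective)⟩

lemma Orthonormal.exists_inner_eq [CompleteSpace H] {v : ℕ → H} (hv : Orthonormal ℂ v) {c : ℕ → ℂ}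
    (hc : ∀ n, ‖c n‖ ≤ (1 / 2) ^ n) : ∃ y : H, ‖y‖ ≤ 2 ∧ ∀ n, ⟪v n, y⟫_ℂ = c n := by
  have hn : ∀ n, ‖c n • v n‖ ≤ (1 / 2) ^ n := fun n => by
    rw [norm_smul, hv.1, mul_one]; exact hc n
  have hs : Summable fun n => c n • v n :=
    Summable.of_norm_bounded hasSum_geometric_two.summable hn
  refine ⟨∑' n, c n • v n, tsum_of_norm_bounded hasSum_geometric_two hn, fun n => ?_⟩
  have := (innerSL ℂ (v n)).map_tsum hs
  rw [innerSL_apply_apply] at this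
  rw [this, tsum_eq_single n]
  · simp [inner_self_eq_norm_sq_to_K, hv.1]
  · intro m hm
    simp [hv.2 hm.symm]

namespace IsStandardOperatorAlgebra

variable [CompleteSpace H] {𝒜 : StarSubalgebra ℂ (H →L[ℂ] H)}
  (h𝒜 : IsStandardOperatorAlgebra 𝒜.toSubalgebra)
include h𝒜

lemma rankOne_mem (x y : H) : InnerProductSpace.rankOne ℂ x y ∈ 𝒜 := by
  refine h𝒜 _ (Submodule.finiteDimensional_of_le (S₂ := ℂ ∙ x) ?_)
  rintro _ ⟨z, rfl⟩
  exact Submodule.mem_span_singleton.2 ⟨_, rfl⟩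

/-- The operator `z ↦ ⟪y, z⟫ x` as an element of a standard operator algebra. -/
noncomputable def rankOne (x y : H) : 𝒜 := ⟨InnerProductSpace.rankOne ℂ x y, h𝒜.rankOne_mem x y⟩

lemma rankOne_apply (x y z : H) : (h𝒜.rankOne x y : H →L[ℂ] H) z = ⟪y, z⟫_ℂ • x := rfl

lemma rankOne_add (x x' y : H) :
    h𝒜.rankOne (x + x') y = h𝒜.rankOne x y + h𝒜.rankOne x' y := by
  ext z; simp [rankOne_apply]

lemma mul_rankOne (a : 𝒜) (x y : H) :
    a * h𝒜.rankOne x y = h𝒜.rankOne ((a : H →L[ℂ] H) x) y := by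
  ext z; simp [rankOne_apply]

/-- Primeness, seen on rank-one `y`; it supplies the faithfulness hypotheses of the additivity
theorem. -/
lemma eq_zero_of_mul_eq_zero {a b : 𝒜} (h : ∀ y, a * y * b = 0) (hb : b ≠ 0) : a = 0 := by
  obtain ⟨v, hv⟩ : ∃ v, (b : H →L[ℂ] H) v ≠ 0 := by
    by_contra! hcon
    exact hb (by ext v; simp [hcon v])
  ext u
  have := congrArg (fun t : 𝒜 => (t : H →L[ℂ] H) v) (h (h𝒜.rankOne u ((b : H →L[ℂ] H) v)))
  simp only [mul_rankOne] at this
  simpa [rankOne_apply, hv] using this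

lemma isProjectionPair {e : H} (he : ‖e‖ = 1) :
    IsProjectionPair (h𝒜.rankOne e e) (1 - h𝒜.rankOne e e) := by
  have hi : h𝒜.rankOne e e * h𝒜.rankOne e e = h𝒜.rankOne e e := by
    rw [mul_rankOne, rankOne_apply, inner_self_eq_norm_sq_to_K, he]; simp
  have hs : star (h𝒜.rankOne e e) = h𝒜.rankOne e e := by
    apply Subtype.ext
    simp [rankOne, ContinuousLinearMap.star_eq_adjoint]
  refine ⟨hi, ?_, ?_, ?_, by abel, hs, by rw [star_sub, star_one, hs]⟩
  · rw [mul_sub, mul_one, sub_mul, one_mul, hi]; abel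
  · rw [mul_sub, mul_one, hi, sub_self]
  · rw [sub_mul, one_mul, hi, sub_self]

lemma map_add_of_isMixedJordanTripleStarDerivation (hH : ¬ FiniteDimensional ℂ H) {Φ : 𝒜 → 𝒜}
    (hΦ : IsMixedJordanTripleStarDerivation Φ) (x y : 𝒜) : Φ (x + y) = Φ x + Φ y := by
  obtain ⟨v, hv⟩ := exists_orthonormal_nat hH
  have e0 : h𝒜.rankOne (v 0) (v 0) ≠ 0 := by
    intro h
    have := congrArg (fun t : 𝒜 => ⟪v 0, (t : H →L[ℂ] H) (v 0)⟫_ℂ) h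
    simp [rankOne_apply, inner_self_eq_norm_sq_to_K, hv.1] at this
  have e1 : 1 - h𝒜.rankOne (v 0) (v 0) ≠ 0 := by
    intro h
    have := congrArg (fun t : 𝒜 => ⟪v 1, (t : H →L[ℂ] H) (v 1)⟫_ℂ) h
    simp [rankOne_apply, inner_self_eq_norm_sq_to_K, hv.1, hv.2 zero_ne_one] at this
  exact hΦ.map_add (h𝒜.isProjectionPair (hv.1 0)) (fun x hx => h𝒜.eq_zero_of_mul_eq_zero hx e1)
    (fun x hx => h𝒜.eq_zero_of_mul_eq_zero hx e0) x y

/-- Additive derivations of a standard operator algebra on an infinite-dimensional Hilbert space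
that commute with multiplication by `i` are implemented by bounded operators. -/
theorem exists_eq_commutator (hH : ¬ FiniteDimensional ℂ H) {d : 𝒜 → 𝒜}
    (hadd : ∀ a b, d (a + b) = d a + d b) (hI : ∀ a, d (Complex.I • a) = Complex.I • d a)
    (hmul : ∀ a b, d (a * b) = d a * b + a * d b) :
    ∃ T : H →L[ℂ] H, ∀ a : 𝒜, (d a : H →L[ℂ] H) = T * (a : H →L[ℂ] H) - (a : H →L[ℂ] H) * T := by
  obtain ⟨v, hv⟩ := exists_orthonormal_nat hH
  obtain ⟨e, he⟩ : ∃ e, e = v 0 := ⟨_, rfl⟩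
  have ne : ‖e‖ = 1 := by rw [he, hv.1]
  have hee : ⟪e, e⟫_ℂ = 1 := by rw [inner_self_eq_norm_sq_to_K, ne]; simp
  -- If `d a = S a - a S`, this equals `S y - ⟪e, S e⟫ y`, so it recovers `S` up to a scalar.
  let T : H → H := fun y => (d (h𝒜.rankOne y e) : H →L[ℂ] H) e
  have Tadd : ∀ x y, T (x + y) = T x + T y := fun x y => by
    simp [T, rankOne_add, hadd]
  have Tapply : ∀ (a : 𝒜) y, T ((a : H →L[ℂ] H) y) =
      (d a : H →L[ℂ] H) y + (a : H →L[ℂ] H) (T y) := fun a y => by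
    simp only [T, ← mul_rankOne, hmul]
    simp [rankOne_apply, ne]
  let f : ℝ →+ ℂ := AddMonoidHom.mk' (fun r => ⟪e, (d ((r : ℂ) • 1) : H →L[ℂ] H) e⟫_ℂ)
    (fun r s => by simp [add_smul, hadd])
  have f1 : f 1 = 0 := by
    have := hmul 1 1
    simp only [mul_one, one_mul, left_eq_add] at this
    simp [f, this]
  -- `d (r 1)` commutes with rank-one operators, hence is scalar; `f` measures the failure of real
  -- homogeneity.
  have dreal : ∀ (r : ℝ) x, (d ((r : ℂ) • 1) : H →L[ℂ] H) x = f r • x := by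
    intro r x
    have k : d ((r : ℂ) • 1) * h𝒜.rankOne x e = h𝒜.rankOne x e * d ((r : ℂ) • 1) := by
      have k1 := hmul ((r : ℂ) • 1) (h𝒜.rankOne x e)
      have k2 := hmul (h𝒜.rankOne x e) ((r : ℂ) • 1)
      rw [smul_mul_assoc, one_mul] at k1
      rw [mul_smul_comm, mul_one, k1, smul_mul_assoc, one_mul, mul_smul_comm, mul_one,
        add_comm] at k2
      exact add_left_cancel k2
    have := congrArg (fun t : 𝒜 => (t : H →L[ℂ] H) e) k
    simpa [rankOne_apply, ne, f] using this
  have Treal : ∀ (r : ℝ) y, T ((r : ℂ) • y) = f r • y + (r : ℂ) • T y := fun r y => by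
    have := Tapply ((r : ℂ) • 1) y
    rw [dreal] at this
    simpa using this
  have TI : ∀ y, T (Complex.I • y) = Complex.I • T y := fun y => by
    have d1 : d 1 = 0 := by simpa using hmul 1 1
    have := Tapply (Complex.I • 1) y
    rw [hI, d1] at this
    simpa using this
  have f0 : ∀ r, f r = 0 := by
    by_contra! hcon
    obtain ⟨c₀, hc₀⟩ := hcon
    -- Choose tiny `c n` with `f (c n)` huge and one vector `y` having all the coordinates `c n`.
    -- Applying `Tapply` to `e ⊗ v n` at `y` bounds `‖f (c n)‖` by `2 K n + ‖T y‖ + ‖T e‖`, which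
    -- fails once `n > ‖T y‖`.
    let K : ℕ → ℝ := fun n => ‖(d (h𝒜.rankOne e (v n)) : H →L[ℂ] H)‖
    choose c hc1 hc2 using fun n : ℕ => exists_small_of_additive f f1 hc₀
      (show (0 : ℝ) < (1 / 2) ^ n by positivity) (n + K n * 2 + ‖T e‖)
    obtain ⟨y, hy, hvy⟩ := hv.exists_inner_eq (c := fun n => (c n : ℂ)) (by simpa using hc1)
    obtain ⟨n, hn⟩ := exists_nat_gt ‖T y‖
    have key := Tapply (h𝒜.rankOne e (v n)) y
    rw [rankOne_apply, rankOne_apply, hvy, Treal] at key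
    have k1 : ‖f (c n)‖ = ‖f (c n) • e‖ := by rw [norm_smul, ne, mul_one]
    have k2 : ‖f (c n) • e‖ ≤ K n * 2 + ‖T y‖ + ‖T e‖ := by
      rw [eq_sub_of_add_eq key]
      refine (norm_sub_le _ _).trans (add_le_add ((norm_add_le _ _).trans (add_le_add ?_ ?_)) ?_)
      · exact (ContinuousLinearMap.le_opNorm _ _).trans
          (mul_le_mul_of_nonneg_left hy (norm_nonneg _))
      · rw [norm_smul, ne, mul_one]
        exact (norm_inner_le_norm _ _).trans (by rw [hv.1, one_mul])
      · rw [norm_smul]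
        refine mul_le_of_le_one_left (norm_nonneg _) ?_
        simpa using (hc1 n).trans (pow_le_one₀ (by norm_num) (by norm_num))
    have := hc2 n
    linarith
  have Tsmul : ∀ (c : ℂ) y, T (c • y) = c • T y := fun c y => by
    have hr : ∀ (r : ℝ) y, T ((r : ℂ) • y) = (r : ℂ) • T y := fun r y => by
      rw [Treal, f0, zero_smul, zero_add]
    rw [← Complex.re_add_im c, add_smul, Tadd, add_smul, hr, mul_smul, mul_smul, hr, TI]
  let L : H →ₗ[ℂ] H := { toFun := T, map_add' := Tadd, map_smul' := Tsmul }
  -- This makes every `⟪w, T ·⟫` continuous, so the graph of `T` is closed.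
  have hinner : ∀ w y, ⟪w, T y⟫_ℂ =
      ⟪e, T e⟫_ℂ * ⟪w, y⟫_ℂ - ⟪e, (d (h𝒜.rankOne e w) : H →L[ℂ] H) y⟫_ℂ := fun w y => by
    have key := Tapply (h𝒜.rankOne e w) y
    rw [rankOne_apply, rankOne_apply, Tsmul] at key
    have key' := congrArg (fun z => ⟪e, z⟫_ℂ) key
    simp only [inner_add_right, inner_smul_right, hee, mul_one] at key'
    rw [mul_comm, key']; ring
  have hcont : Continuous L := L.continuous_of_seq_closed_graph fun u x y hu hTu => by
    refine ext_inner_left ℂ fun w => ?_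
    have t1 : Filter.Tendsto (fun n => ⟪w, T (u n)⟫_ℂ) Filter.atTop (nhds ⟪w, y⟫_ℂ) :=
      ((innerSL ℂ w).continuous.tendsto y).comp hTu
    have t2 : Filter.Tendsto (fun n => ⟪w, T (u n)⟫_ℂ) Filter.atTop (nhds ⟪w, T x⟫_ℂ) := by
      have : Continuous fun z => ⟪w, T z⟫_ℂ := by
        rw [funext (hinner w)]
        fun_prop
      exact (this.tendsto x).comp hu
    exact tendsto_nhds_unique t1 t2
  refine ⟨⟨L, hcont⟩, fun a => ?_⟩
  ext y
  exact eq_sub_of_add_eq (Tapply a y).symm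

end IsStandardOperatorAlgebra

end Inner

/-! ### The main theorem -/

theorem corollary3p4 {H : Type*} [NormedAddCommGroup H] [InnerProductSpace ℂ H] [CompleteSpace H]
    (hH : ¬ FiniteDimensional ℂ H)
    (𝒜 : StarSubalgebra ℂ (H →L[ℂ] H)) (h𝒜 : IsStandardOperatorAlgebra 𝒜.toSubalgebra)
    (Φ : 𝒜 → 𝒜) :
    (IsMixedJordanTripleStarDerivation Φ ↔ IsLinearStarDerivation Φ) ∧
      (IsMixedJordanTripleStarDerivation Φ →
        ∃ T : H →L[ℂ] H, T + ContinuousLinearMap.adjoint T = 0 ∧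
          ∀ A : 𝒜, (Φ A : H →L[ℂ] H) = (A : H →L[ℂ] H) * T - T * (A : H →L[ℂ] H)) := by
  refine ⟨⟨fun h => ?_, fun h => h.isMixedJordanTripleStarDerivation⟩, fun h => ?_⟩
  all_goals
    have hadd := h𝒜.map_add_of_isMixedJordanTripleStarDerivation hH h
    have hmul := h.leibniz hadd
    have hstar := h.map_star hadd
    obtain ⟨T, hT⟩ := h𝒜.exists_eq_commutator hH hadd (h.map_I_smul hadd) hmul
  · refine ⟨⟨hadd, fun c a => Subtype.ext ?_⟩, hmul, hstar⟩
    simp [hT, smul_sub]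
  · have hcomm : ∀ a : 𝒜, (a : H →L[ℂ] H) * (T + star T) = (T + star T) * a := fun a => by
      have := congrArg (fun t : 𝒜 => star (t : H →L[ℂ] H)) (hstar a)
      simp only [StarMemClass.coe_star, star_star, hT, star_sub, star_mul] at this
      rw [mul_add, add_mul]
      rw [← sub_eq_zero] at this ⊢
      rw [← this]
      abel
    -- As `T + T*` commutes with `𝒜`, `T` and its skew part `(T - T*)/2` give the same commutators;
    -- the sign flips because the target is `AT - TA`.
    refine ⟨(2⁻¹ : ℂ) • (star T - T), ?_, fun a => ?_⟩
    · rw [← ContinuousLinearMap.star_eq_adjoint, star_smul, star_sub, star_star]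
      simp only [RCLike.star_def, map_inv₀, Complex.conj_ofNat, ← smul_add]
      simp
    · have h2 : (2 : ℂ) • (T * (a : H →L[ℂ] H) - a * T) =
          (a : H →L[ℂ] H) * (star T - T) - (star T - T) * a := by
        have := hcomm a
        rw [← sub_eq_zero] at this ⊢
        rw [← neg_eq_zero, ← this, two_smul]
        noncomm_ring
      rw [hT, mul_smul_comm, smul_mul_assoc, ← smul_sub, ← h2, smul_smul]
      norm_num
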